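/- Let $K$ be an algebraically closed field that is complete with respect to a nontrivial nonarchimedean absolute value $|\cdot|$, and let $\|x\|=\max_i|x_i|$ on $K^{N+1}$. For $P=(x_0:\dots:x_N)$ and $Q=(y_0:\dots:y_N)$ in $\mathbb{P}^N(K)$ let $$\Delta(P,Q)=\frac{\max_{0\le i,j\le N}|x_iy_j-x_jy_i|}{\|x\|\,\|y\|}$$ be the chordal distance. Let $\varphi:\mathbb{P}^N\to\mathbb{P}^N$ be a morphism of degree $d\ge 2$ over $K$, and let $\Phi=(\Phi_0,\dots,\Phi_N)$ be a lift of $\varphi$, that is, homogeneous polynomials of degree $d$ over $K$ without a common zero in $K^{N+1}\setminus\{0\}$ that give $\varphi$ in homogeneous coordinates. A lift is minimal if all its coefficients have absolute value at most $1$ and at least one has absolute value exactly $1$. Let $\operatorname{Res}(\varphi)$ be a minimal resultant of $\varphi$, that is, the Macaulay resultant of a minimal lift of $\varphi$; here the Macaulay resultant of $N+1$ forms of degree $d$ in $N+1$ variables is the polynomial with integer coefficients in the coefficients of the forms that generates the elimination ideal of the generic forms over $\mathbb{Z}$ (the ideal of those polynomials $a$ in the coefficients such that for every $j$ some $X_j^k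 a$ lies in the ideal generated by the generic forms) and takes the value $1$ at $X_0^d,\dots,X_N^d$. A minimal resultant exists, and every minimal resultant is nonzero. Define $g_\Phi:\mathbb{P}^N(K)\to\mathbb{R}$ by $$g_\Phi(P)=\frac1d\log\|\Phi(x)\|-\log\|x\|$$ for any $x\in K^{N+1}\setminus\{0\}$ representing $P$; this does not depend on the choice of $x$. Then $g_\Phi$ is Lipschitz continuous with respect to the chordal metric. More precisely, for all $P,Q\in\mathbb{P}^N(K)$, $$|g_\Phi(P)-g_\Phi(Q)|\le\frac{\log(|\operatorname{Res}(\varphi)|^{-1})}{d\,|\operatorname{Res}(\varphi)|}\,\Delta(P,Q).$$ Further, $g_\Phi(P)=g_\Phi(Q)$ whenever $\Delta(P,Q)<|\operatorname{Res}(\varphi)|$. In particular, $g_\Phi$ is uniformly locally constant: there is an $\varepsilon>0$ such that $g_\Phi(P)=g_\Phi(Q)$ whenever $\Delta(P,Q)<\varepsilon$. -/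

import Mathlib

open scoped LinearAlgebra.Projectivization

namespace NonarchGreen

noncomputable section

/-! ### The Macaulay resultant of `N + 1` forms of degree `d` in `N + 1` variables -/

section Resultant

/-- The exponent vectors of the monomials of degree `d` in `X_0, …, X_N`. -/
abbrev Mon (N d : ℕ) : Type :=
  {m : Fin (N + 1) →₀ ℕ // m ∈ (Finset.univ : Finset (Fin (N + 1))).finsuppAntidiag d}

/-- The ring `ℤ[c]` of polynomials in the indeterminate coefficients `c_{i,m}` of `N + 1` generic
forms of degree `d` in `N + 1` variables. -/
abbrev CoeffRing (N d : ℕ) : Type := MvPolynomial (Fin (N + 1) × Mon N d) ℤ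

/-- The `i`-th generic form `∑_m c_{i,m} X^m` of degree `d`, an element of `ℤ[c][X_0, …, X_N]`. -/
def genericForm (N d : ℕ) (i : Fin (N + 1)) : MvPolynomial (Fin (N + 1)) (CoeffRing N d) :=
  ∑ m : Mon N d, MvPolynomial.monomial m.1 (MvPolynomial.X (i, m))

/-- The ideal of `ℤ[c][X]` generated by the generic forms. -/
def genericIdeal (N d : ℕ) : Ideal (MvPolynomial (Fin (N + 1)) (CoeffRing N d)) :=
  Ideal.span (Set.range (genericForm N d))

/-- The elimination ideal of the generic forms (inertia forms of degree `0`): all `a ∈ ℤ[c]` such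
that every `X_j` has a power `X_j ^ k` with `X_j ^ k * a` in the ideal of the generic forms. -/
def elimIdeal (N d : ℕ) : Ideal (CoeffRing N d) where
  carrier := {a | ∀ j : Fin (N + 1), ∃ k : ℕ,
    MvPolynomial.X j ^ k * MvPolynomial.C a ∈ genericIdeal N d}
  zero_mem' := fun j => ⟨0, by simp⟩
  add_mem' := by
    intro a b ha hb j
    obtain ⟨k, hk⟩ := ha j
    obtain ⟨l, hl⟩ := hb j
    refine ⟨k + l, ?_⟩
    have h := Ideal.add_mem _ (Ideal.mul_mem_left _ (MvPolynomial.X j ^ l) hk)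
      (Ideal.mul_mem_left _ (MvPolynomial.X j ^ k) hl)
    convert h using 1
    rw [map_add, pow_add]
    ring
  smul_mem' := by
    intro c a ha j
    obtain ⟨k, hk⟩ := ha j
    refine ⟨k, ?_⟩
    have h := Ideal.mul_mem_left _ (MvPolynomial.C c) hk
    convert h using 1
    rw [smul_eq_mul, map_mul]
    ring

/-- The coefficients of the forms `X_0 ^ d, …, X_N ^ d`. -/
def purePowerCoeff (N d : ℕ) (p : Fin (N + 1) × Mon N d) : ℤ :=
  if p.2.1 = Finsupp.single p.1 d then 1 else 0

/-- `R ∈ ℤ[c]` is the Macaulay resultant: it generates the elimination ideal of the generic forms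
and takes the value `1` at the forms `X_0 ^ d, …, X_N ^ d`. -/
def IsMacaulayResultant (N d : ℕ) (R : CoeffRing N d) : Prop :=
  Ideal.span {R} = elimIdeal N d ∧ MvPolynomial.eval (purePowerCoeff N d) R = 1

theorem IsMacaulayResultant.unique {N d : ℕ} {R S : CoeffRing N d}
    (hR : IsMacaulayResultant N d R) (hS : IsMacaulayResultant N d S) : R = S := by
  have h : Associated R S := Ideal.span_singleton_eq_span_singleton.1 (hR.1.trans hS.1.symm)
  obtain ⟨u, rfl⟩ := h
  obtain ⟨c, -, hc⟩ := MvPolynomial.isUnit_iff_eq_C_of_isReduced.1 u.isUnit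
  have h2 := hS.2
  rw [map_mul, hR.2, one_mul, hc, MvPolynomial.eval_C] at h2
  rw [hc, h2, map_one, mul_one]

/-- The Macaulay resultant as a polynomial with integer coefficients in the coefficients of `N + 1`
forms of degree `d`. -/
def resultantPoly (N d : ℕ) : CoeffRing N d :=
  Classical.epsilon (IsMacaulayResultant N d)

/-- The Macaulay resultant `Res(Φ)` of forms `Φ_0, …, Φ_N` of degree `d` over a commutative ring:
the value of the resultant polynomial at the coefficients of the `Φ_i`. -/
def resultant {A : Type*} [CommRing A] {N : ℕ} (d : ℕ)
    (Φ : Fin (N + 1) → MvPolynomial (Fin (N + 1)) A) : A :=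
  MvPolynomial.aeval (fun p : Fin (N + 1) × Mon N d => (Φ p.1).coeff p.2.1) (resultantPoly N d)

end Resultant

section Projective

variable {K : Type*} [NontriviallyNormedField K] {N : ℕ}

/-- The chordal distance on `ℙ^N(K)`. The norm of `Fin (N + 1) → K` is the sup norm, and the
iterated supremum is the maximum over the finitely many pairs of indices. By `chordalDist_mk` any
lifts of the two points may be used. -/
def chordalDist (P Q : ℙ K (Fin (N + 1) → K)) : ℝ :=
  (⨆ p : Fin (N + 1) × Fin (N + 1), ‖P.rep p.1 * Q.rep p.2 - P.rep p.2 * Q.rep p.1‖) /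
    (‖P.rep‖ * ‖Q.rep‖)

theorem chordalDist_mk (x y : Fin (N + 1) → K) (hx : x ≠ 0) (hy : y ≠ 0) :
    chordalDist (Projectivization.mk K x hx) (Projectivization.mk K y hy) =
      (⨆ p : Fin (N + 1) × Fin (N + 1), ‖x p.1 * y p.2 - x p.2 * y p.1‖) / (‖x‖ * ‖y‖) := by
  obtain ⟨a, ha⟩ := Projectivization.exists_smul_eq_mk_rep K x hx
  obtain ⟨b, hb⟩ := Projectivization.exists_smul_eq_mk_rep K y hy
  have ha0 : ‖(a : K)‖ ≠ 0 := norm_ne_zero_iff.2 a.ne_zero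
  have hb0 : ‖(b : K)‖ ≠ 0 := norm_ne_zero_iff.2 b.ne_zero
  unfold chordalDist
  rw [← ha, ← hb]
  have h : ∀ p : Fin (N + 1) × Fin (N + 1),
      ‖(a • x) p.1 * (b • y) p.2 - (a • x) p.2 * (b • y) p.1‖ =
        (‖(a : K)‖ * ‖(b : K)‖) * ‖x p.1 * y p.2 - x p.2 * y p.1‖ := by
    intro p
    rw [← norm_mul, ← norm_mul]
    congr 1
    simp only [Pi.smul_apply, Units.smul_def, smul_eq_mul]
    ring
  simp_rw [h]
  rw [← Real.mul_iSup_of_nonneg (by positivity), Units.smul_def, Units.smul_def, norm_smul,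
    norm_smul, mul_mul_mul_comm, mul_div_mul_left _ _ (mul_ne_zero ha0 hb0)]

/-- The map `K^{N+1} → K^{N+1}` given by the polynomials `Φ_0, …, Φ_N`. -/
def polyMap (Φ : Fin (N + 1) → MvPolynomial (Fin (N + 1)) K) (x : Fin (N + 1) → K) :
    Fin (N + 1) → K :=
  fun i => MvPolynomial.eval x (Φ i)

/-- `Φ` is a lift of the self-map `φ` of `ℙ^N(K)`, and `φ` is a morphism of degree `d`: the `Φ_i`
are forms of degree `d` without a common zero other than `0`, and they give `φ` in homogeneous
coordinates. -/
structure IsLift (d : ℕ) (φ : ℙ K (Fin (N + 1) → K) → ℙ K (Fin (N + 1) → K))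
    (Φ : Fin (N + 1) → MvPolynomial (Fin (N + 1)) K) : Prop where
  isHomogeneous : ∀ i, (Φ i).IsHomogeneous d
  ne_zero : ∀ x : Fin (N + 1) → K, x ≠ 0 → polyMap Φ x ≠ 0
  map_mk : ∀ (x : Fin (N + 1) → K) (hx : x ≠ 0),
    φ (Projectivization.mk K x hx) = Projectivization.mk K (polyMap Φ x) (ne_zero x hx)

/-- `φ` is (the map on `K`-points of) a morphism `ℙ^N → ℙ^N` of degree `d`. -/
def IsMorphismOfDegree (d : ℕ) (φ : ℙ K (Fin (N + 1) → K) → ℙ K (Fin (N + 1) → K)) : Prop :=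
  ∃ Φ, IsLift d φ Φ

/-- A minimal lift: all coefficients are integral and at least one of them is a unit. -/
structure IsMinimalLift (d : ℕ) (φ : ℙ K (Fin (N + 1) → K) → ℙ K (Fin (N + 1) → K))
    (Φ : Fin (N + 1) → MvPolynomial (Fin (N + 1)) K) : Prop extends IsLift d φ Φ where
  integral : ∀ i m, ‖(Φ i).coeff m‖ ≤ 1
  exists_unit : ∃ i m, ‖(Φ i).coeff m‖ = 1

/-- `ρ` is a minimal resultant of `φ`: the resultant of some minimal lift of `φ`. -/
def IsMinimalResultant (d : ℕ) (φ : ℙ K (Fin (N + 1) → K) → ℙ K (Fin (N + 1) → K)) (ρ : K) :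
    Prop :=
  ∃ Ψ, IsMinimalLift d φ Ψ ∧ ρ = resultant d Ψ

/-- The function `g_Φ(P) = (1/d) log ‖Φ(x)‖ - log ‖x‖` on `ℙ^N(K)`, where `x` is a lift of `P`. -/
def gFun (d : ℕ) (Φ : Fin (N + 1) → MvPolynomial (Fin (N + 1)) K)
    (P : ℙ K (Fin (N + 1) → K)) : ℝ :=
  1 / (d : ℝ) * Real.log ‖polyMap Φ P.rep‖ - Real.log ‖P.rep‖

end Projective

end

end NonarchGreen

namespace NonarchGreen

open MvPolynomial

/-! The analytic half rests on one bound. Two lifts of `φ` are proportional, so their functions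
differ by a constant and `Φ` may be replaced by a minimal lift `Ψ`, with resultant `ρ`. For `‖x‖ =
1`, integrality gives `‖Ψ(x)‖ ≤ 1`. Since `ρ` comes from the elimination ideal, some `X_j ^ k * ρ`
with `|x_j| = 1` is a combination of the `Ψ_i` with integral coefficients, so `|ρ| ≤ ‖Ψ(x)‖`. Hence
`log|ρ| / d ≤ g_Ψ ≤ 0`. Moreover `Ψ` is 1-Lipschitz on the unit ball: if `Δ(P,Q) < |ρ|`, unit
representatives satisfy `‖Ψ(x) - Ψ(y)‖ < |ρ| ≤ ‖Ψ(x)‖`, and the ultrametric inequality forces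
`‖Ψ(x)‖ = ‖Ψ(y)‖`. If `Δ(P,Q) ≥ |ρ|`, the range of `g_Ψ` already gives the Lipschitz bound.

The algebraic half shows that the resultant exists and that `ρ ≠ 0`. The elimination ideal is prime,
because inverting `X_j` allows solving the generic equations for the coefficients of `X_j ^ d`. It
contains no nonzero element free of one chosen coefficient, so Gauss's lemma makes it principal.
Minors of Macaulay matrices give elements of the ideal not vanishing at prescribed forms without a
common zero (`exists_mem_elimIdeal_specialize_ne_zero`). Modulo each prime number this makes the
generator `±1` at the pure powers; over `K` it gives `ρ ≠ 0`. -/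

/-! ### Minors and principal prime ideals -/

theorem exists_submatrix_det_ne_zero {ι κ k : Type*} [Fintype ι] [DecidableEq ι] [Fintype κ]
    [Field k] (M : Matrix ι κ k) (V : Matrix κ ι k) (h : M * V = 1) :
    ∃ f : ι → κ, (M.submatrix id f).det ≠ 0 := by
  by_contra! hall
  -- By multilinearity in the columns, as in Cauchy–Binet, `det (M * V)` is a combination of the
  -- maximal minors of `M`.
  have key : (M * V).det = ∑ f : ι → κ, (∏ j, V (f j) j) * (M.submatrix id f).det := by
    have h1 : (M * V).transpose = fun j : ι => ∑ l : κ, V l j • (fun i => M i l) := by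
      ext j i
      simp [Matrix.mul_apply, mul_comm]
    rw [← Matrix.det_transpose, h1]
    refine (Matrix.detRowAlternating.toMultilinearMap.map_sum
      (fun (j : ι) (l : κ) => V l j • (fun i => M i l))).trans ?_
    refine Finset.sum_congr rfl fun f _ => ?_
    rw [MultilinearMap.map_smul_univ, smul_eq_mul, ← Matrix.det_transpose (M.submatrix id f)]
    rfl
  rw [h, Matrix.det_one] at key
  simp [hall] at key

/-- If a matrix over `R` becomes right invertible over a field, then some element of `R` that is
nonzero in the field multiplies every vector into the column space. -/
theorem exists_smul_single_mem_range_mulVec {ι κ R k : Type*} [Fintype ι] [DecidableEq ι]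
    [Fintype κ] [DecidableEq κ] [CommRing R] [Field k] (φ : R →+* k) (M : Matrix ι κ R)
    (V : Matrix κ ι k) (h : M.map φ * V = 1) :
    ∃ a : R, φ a ≠ 0 ∧ ∀ i, ∃ v : κ → R, M.mulVec v = Pi.single i a := by
  obtain ⟨f, hf⟩ := exists_submatrix_det_ne_zero _ V h
  refine ⟨(M.submatrix id f).det, ?_, fun i => ?_⟩
  · rw [RingHom.map_det]
    exact hf
  -- Column `i` of the adjugate, placed on the columns selected by `f`.
  · refine ⟨fun l => ∑ j, if f j = l then (M.submatrix id f).adjugate j i else 0, ?_⟩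
    have h1 := congrFun (congrArg Matrix.transpose
      (Matrix.mul_adjugate (M.submatrix id f))) i
    ext i'
    have h2 := congrFun h1 i'
    simp only [Matrix.transpose_apply, Matrix.mul_apply, Matrix.smul_apply, Matrix.one_apply,
      Matrix.submatrix_apply, id] at h2
    simp only [Matrix.mulVec, dotProduct, Finset.mul_sum]
    rw [Finset.sum_comm]
    simp only [mul_ite, mul_zero, Finset.sum_ite_eq, Finset.mem_univ, if_true]
    rw [h2, Pi.single_apply]
    simp

/-- A prime ideal of `A[X]` over a factorial domain `A` that meets `A` in `0` is principal. -/
theorem exists_span_singleton_eq_of_comap_C_eq_bot {A : Type*} [CommRing A] [IsDomain A]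
    [UniqueFactorizationMonoid A] (p : Ideal (Polynomial A)) [hp : p.IsPrime]
    (h : p.comap Polynomial.C = ⊥) : ∃ f, Ideal.span {f} = p := by
  classical
  by_cases h0 : p = ⊥
  · exact ⟨0, by simp [h0]⟩
  obtain ⟨f, hfp, hf⟩ := hp.exists_mem_prime_of_ne_bot h0
  let : NormalizedGCDMonoid A := Classical.choice inferInstance
  have hdeg : f.natDegree ≠ 0 := by
    intro hd
    rw [Polynomial.natDegree_eq_zero] at hd
    obtain ⟨c, rfl⟩ := hd
    have : c ∈ p.comap Polynomial.C := hfp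
    rw [h, Ideal.mem_bot] at this
    exact hf.ne_zero (by simp [this])
  have hprim : f.IsPrimitive := hf.irreducible.isPrimitive hdeg
  have hirr := (hprim.irreducible_iff_irreducible_map_fraction_map
    (K := FractionRing A)).1 hf.irreducible
  refine ⟨f, le_antisymm ((Ideal.span_singleton_le_iff_mem _).2 hfp) fun a ha => ?_⟩
  rw [Ideal.mem_span_singleton]
  -- The extension of `p` to polynomials over the fraction field stays proper because `p` meets `A`
  -- in `0`. An element of `p` not divisible by `f` would be coprime to `f` there and generate the
  -- unit ideal with it.
  have hmap : (p.map (Polynomial.mapRingHom (algebraMap A (FractionRing A)))) ≠ ⊤ := by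
    let := (Polynomial.mapRingHom (algebraMap A (FractionRing A))).toAlgebra
    have : IsLocalization ((nonZeroDivisors A).map (Polynomial.C : A →+* Polynomial A))
        (Polynomial (FractionRing A)) := Polynomial.isLocalization _ _
    refine (IsLocalization.isPrime_of_isPrime_disjoint
      ((nonZeroDivisors A).map (Polynomial.C : A →+* Polynomial A))
      (Polynomial (FractionRing A)) p hp ?_).ne_top
    rw [Set.disjoint_left]
    rintro _ ⟨c, hc, rfl⟩ hcp
    have : c ∈ p.comap Polynomial.C := hcp
    rw [h, Ideal.mem_bot] at this
    exact nonZeroDivisors.ne_zero hc this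
  rw [hprim.dvd_iff_fraction_map_dvd_fraction_map (FractionRing A)]
  by_contra hnd
  rw [← hirr.coprime_iff_not_dvd] at hnd
  obtain ⟨u, v, huv⟩ := hnd
  apply hmap
  rw [Ideal.eq_top_iff_one, ← huv]
  exact Ideal.add_mem _ (Ideal.mul_mem_left _ _ (Ideal.mem_map_of_mem _ hfp))
    (Ideal.mul_mem_left _ _ (Ideal.mem_map_of_mem _ ha))

/-! ### Forms and specialization of the generic coefficients -/

theorem mem_finsuppAntidiag_univ {n d : ℕ} (m : Fin n →₀ ℕ) :
    m ∈ (Finset.univ : Finset (Fin n)).finsuppAntidiag d ↔ m.degree = d := by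
  simp [Finset.mem_finsuppAntidiag, Finsupp.degree_eq_sum]

theorem Mon.degree_eq {N d : ℕ} (m : Mon N d) : m.1.degree = d :=
  (mem_finsuppAntidiag_univ m.1).1 m.2

theorem Mon.eq_sum_of_isHomogeneous {A : Type*} [CommRing A] {N n : ℕ}
    {P : MvPolynomial (Fin (N + 1)) A} (hP : P.IsHomogeneous n) :
    P = ∑ m : Mon N n, monomial m.1 (P.coeff m.1) := by
  classical
  ext e
  simp only [coeff_sum, coeff_monomial]
  by_cases he : e.degree = n
  · rw [Finset.sum_eq_single (⟨e, (mem_finsuppAntidiag_univ e).2 he⟩ : Mon N n)]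
    · simp
    · intro b _ hb
      rw [if_neg]
      exact fun h => hb (Subtype.ext h)
    · simp
  · rw [hP.coeff_eq_zero he, Finset.sum_eq_zero]
    intro m _
    rw [if_neg]
    rintro rfl
    exact he m.degree_eq

theorem genericForm_isHomogeneous (N d : ℕ) (i : Fin (N + 1)) :
    (genericForm N d i).IsHomogeneous d :=
  IsHomogeneous.sum _ _ _ fun m _ => isHomogeneous_monomial _ m.degree_eq

/-- The specialization of the generic coefficients to those of `Ψ`. -/
noncomputable def specialize {A : Type*} [CommRing A] {N : ℕ} (d : ℕ)
    (Ψ : Fin (N + 1) → MvPolynomial (Fin (N + 1)) A) : CoeffRing N d →+* A :=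
  (aeval (R := ℤ) fun p : Fin (N + 1) × Mon N d => (Ψ p.1).coeff p.2.1).toRingHom

theorem resultant_eq_specialize {A : Type*} [CommRing A] {N : ℕ} (d : ℕ)
    (Ψ : Fin (N + 1) → MvPolynomial (Fin (N + 1)) A) :
    resultant d Ψ = specialize d Ψ (resultantPoly N d) := rfl

theorem map_specialize_genericForm {A : Type*} [CommRing A] {N d : ℕ}
    {Ψ : Fin (N + 1) → MvPolynomial (Fin (N + 1)) A} (hΨ : ∀ i, (Ψ i).IsHomogeneous d)
    (i : Fin (N + 1)) : map (specialize d Ψ) (genericForm N d i) = Ψ i := by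
  rw [Mon.eq_sum_of_isHomogeneous (hΨ i), genericForm, map_sum]
  refine Finset.sum_congr rfl fun m _ => ?_
  simp [specialize, map_monomial]

theorem homogeneousComponent_mul_of_isHomogeneous {σ A : Type*} [CommRing A]
    {P Q : MvPolynomial σ A} {n d : ℕ} (hQ : Q.IsHomogeneous d) :
    homogeneousComponent (n + d) (P * Q) = homogeneousComponent n P * Q := by
  conv_lhs => rw [← sum_homogeneousComponent P, Finset.sum_mul, map_sum]
  simp_rw [homogeneousComponent_of_mem (((homogeneousComponent_isHomogeneous _ P).mul hQ)),
    Nat.add_right_cancel_iff]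
  rw [Finset.sum_ite_eq]
  split_ifs with h
  · rfl
  · rw [homogeneousComponent_eq_zero, zero_mul]
    simpa using h

/-! ### Macaulay matrices and nonvanishing on the elimination ideal -/

/-- Forms without a common zero are not a zero of some element of the elimination ideal. -/
theorem exists_mem_elimIdeal_specialize_ne_zero {k : Type*} [Field k] {N d : ℕ}
    {Ψ : Fin (N + 1) → MvPolynomial (Fin (N + 1)) k} (hΨ : ∀ i, (Ψ i).IsHomogeneous d)
    (hX : ∀ j, ∃ l, (X j : MvPolynomial (Fin (N + 1)) k) ^ l ∈ Ideal.span (Set.range Ψ)) :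
    ∃ a ∈ elimIdeal N d, specialize d Ψ a ≠ 0 := by
  classical
  choose l hl using hX
  set L := ∑ j, l j
  have hpow : ∀ j, (X j : MvPolynomial (Fin (N + 1)) k) ^ L ∈ Ideal.span (Set.range Ψ) := fun j =>
    Ideal.pow_mem_of_pow_mem _ (hl j) (Finset.single_le_sum (fun _ _ => Nat.zero_le _)
      (Finset.mem_univ j))
  -- By pigeonhole, a monomial of degree at least `(N + 1) * L` is divisible by some `X_j ^ L`.
  set n := (N + 1) * L with hn
  -- every monomial of degree `n + d` lies in the ideal
  have hmon : ∀ m : Mon N (n + d), monomial m.1 (1 : k) ∈ Ideal.span (Set.range Ψ) := by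
    intro m
    have : ∃ j, L ≤ m.1 j := by
      by_contra! hlt
      have h1 : m.1.degree = n + d := m.degree_eq
      rw [Finsupp.degree_eq_sum] at h1
      have h2 : ∑ j, m.1 j < ∑ _j : Fin (N + 1), L :=
        Finset.sum_lt_sum_of_nonempty Finset.univ_nonempty fun j _ => hlt j
      simp only [Finset.sum_const, Finset.card_univ, Fintype.card_fin, smul_eq_mul] at h2
      omega
    obtain ⟨j, hj⟩ := this
    have : monomial m.1 (1 : k) = monomial (m.1 - Finsupp.single j L) 1 * X j ^ L := by
      rw [X_pow_eq_monomial, monomial_mul, one_mul, tsub_add_cancel_of_le]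
      simpa using hj
    rw [this]
    exact Ideal.mul_mem_left _ _ (hpow j)
  have hcol : ∀ m : Mon N (n + d), ∃ h : Fin (N + 1) → MvPolynomial (Fin (N + 1)) k,
      (∀ i, (h i).IsHomogeneous n) ∧ ∑ i, h i * Ψ i = monomial m.1 1 := by
    intro m
    obtain ⟨h, hh⟩ := Ideal.mem_span_range_iff_exists_fun.1 (hmon m)
    refine ⟨fun i => homogeneousComponent n (h i),
      fun i => homogeneousComponent_isHomogeneous _ _, ?_⟩
    have := congrArg (homogeneousComponent (n + d)) hh
    rw [map_sum, homogeneousComponent_eq_self (isHomogeneous_monomial _ m.degree_eq)] at this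
    rw [← this]
    exact Finset.sum_congr rfl fun i _ => (homogeneousComponent_mul_of_isHomogeneous (hΨ i)).symm
  choose h hhom hsum using hcol
  -- The Macaulay matrix of `(h_i) ↦ ∑ h_i F_i` from degree `n` to degree `n + d`, for the generic
  -- forms `F_i`. The `h m` provide a right inverse after specialization to `Ψ`; the element sought
  -- is a maximal minor.
  let M : Matrix (Mon N (n + d)) (Fin (N + 1) × Mon N n) (CoeffRing N d) :=
    fun m q => (monomial q.2.1 1 * genericForm N d q.1).coeff m.1
  let V : Matrix (Fin (N + 1) × Mon N n) (Mon N (n + d)) k := fun q m => (h m q.1).coeff q.2.1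
  have hMV : M.map (specialize d Ψ) * V = 1 := by
    ext m' m
    have h1 : ∀ q : Fin (N + 1) × Mon N n, specialize d Ψ (M m' q) =
        (monomial q.2.1 1 * Ψ q.1).coeff m'.1 := by
      intro q
      simp only [M]
      rw [← coeff_map, map_mul, map_specialize_genericForm hΨ, map_monomial, map_one]
    have h2 := congrArg (coeff m'.1) (hsum m)
    rw [coeff_monomial, coeff_sum] at h2
    rw [Matrix.mul_apply, Matrix.one_apply, Fintype.sum_prod_type,
      if_congr (show m' = m ↔ m.1 = m'.1 by rw [Subtype.ext_iff, eq_comm]) rfl rfl, ← h2]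
    simp only [Matrix.map_apply, h1, V]
    refine Finset.sum_congr rfl fun i _ => ?_
    conv_rhs => rw [Mon.eq_sum_of_isHomogeneous (hhom m i), Finset.sum_mul, coeff_sum]
    refine Finset.sum_congr rfl fun q _ => ?_
    rw [mul_comm, ← coeff_C_mul, ← mul_assoc, C_mul_monomial, mul_one]
  obtain ⟨a, ha, hv⟩ := exists_smul_single_mem_range_mulVec (specialize d Ψ) M V hMV
  refine ⟨a, fun j => ⟨n + d, ?_⟩, ha⟩
  obtain ⟨v, hv⟩ := hv ⟨Finsupp.single j (n + d), (mem_finsuppAntidiag_univ _).2 (by simp)⟩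
  have hX : X j ^ (n + d) * C a =
      ∑ q : Fin (N + 1) × Mon N n, C (v q) * (monomial q.2.1 1 * genericForm N d q.1) := by
    have hR : (∑ q : Fin (N + 1) × Mon N n,
        C (v q) * (monomial q.2.1 1 * genericForm N d q.1)).IsHomogeneous (n + d) :=
      IsHomogeneous.sum _ _ _ fun q _ => ((isHomogeneous_monomial _ q.2.degree_eq).mul
        (genericForm_isHomogeneous N d q.1)).C_mul _
    have hXm : X j ^ (n + d) * C a = monomial (Finsupp.single j (n + d)) a := by
      rw [mul_comm, X_pow_eq_monomial, C_mul_monomial, mul_one]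
    have hLh : (X j ^ (n + d) * C a : MvPolynomial (Fin (N + 1)) (CoeffRing N d)).IsHomogeneous
        (n + d) := by
      rw [hXm]
      exact isHomogeneous_monomial _ (by simp)
    rw [Mon.eq_sum_of_isHomogeneous hR, Mon.eq_sum_of_isHomogeneous hLh]
    refine Finset.sum_congr rfl fun m _ => ?_
    congr 1
    have := congrFun hv m
    rw [Matrix.mulVec, dotProduct, Pi.single_apply] at this
    rw [hXm, coeff_monomial, coeff_sum]
    simp only [coeff_C_mul]
    rw [show (if Finsupp.single j (n + d) = m.1 then a else 0) = _ from
      (if_congr (by rw [Subtype.ext_iff, eq_comm]) rfl rfl).trans this.symm]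
    exact Finset.sum_congr rfl fun q _ => mul_comm _ _
  rw [hX]
  exact Ideal.sum_mem _ fun q _ => Ideal.mul_mem_left _ _ (Ideal.mul_mem_left _ _
    (Ideal.subset_span ⟨q.1, rfl⟩))

/-! ### The elimination ideal is prime -/

/-- The exponent vector of `X_j ^ d`. -/
noncomputable def Mon.pure {N : ℕ} (d : ℕ) (j : Fin (N + 1)) : Mon N d :=
  ⟨Finsupp.single j d, (mem_finsuppAntidiag_univ _).2 (by simp)⟩

/-- The polynomial ring `ℤ[c][X_0, …, X_N]`. -/
abbrev FormRing (N d : ℕ) : Type := MvPolynomial (Fin (N + 1)) (CoeffRing N d)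

/-- The embedding of `ℤ[c][X_0, …, X_N]` into its field of fractions. -/
noncomputable abbrev toFrac (N d : ℕ) : FormRing N d →+* FractionRing (FormRing N d) :=
  algebraMap _ _

open Classical in
/-- The retraction of `ℤ[c][X]` onto its quotient by the generic forms, after inverting `X_j`: the
coefficient of `X_j ^ d` in each form is solved for. -/
noncomputable def solveAt (N d : ℕ) (j : Fin (N + 1)) :
    FormRing N d →+*
      FractionRing (FormRing N d) :=
  eval₂Hom (eval₂Hom (Int.castRingHom _) fun p =>
      toFrac N d (C (X p)) -
        if p.2 = Mon.pure d j then toFrac N d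
          (genericForm N d p.1) / toFrac N d (X j) ^ d else 0)
    fun i => toFrac N d (X i)

section

variable {N d : ℕ} (j : Fin (N + 1))

theorem algebraMap_X_ne_zero :
    toFrac N d (X j) ≠ 0 := by
  rw [Ne, IsFractionRing.to_map_eq_zero_iff]
  exact X_ne_zero j

@[simp]
theorem solveAt_X (i : Fin (N + 1)) : solveAt N d j (X i) = toFrac N d (X i) := by
  simp [solveAt]

/-- Lowering the coefficient of `X_j ^ d` by `F_i / X_j ^ d` subtracts exactly `F_i` from `F_i`. -/
theorem solveAt_genericForm (i : Fin (N + 1)) : solveAt N d j (genericForm N d i) = 0 := by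
  classical
  have h : ∀ m : Mon N d, solveAt N d j (monomial m.1 (X (i, m))) =
      toFrac N d (monomial m.1 (X (i, m))) -
        if m = Mon.pure d j then toFrac N d
          (genericForm N d i) else 0 := by
    intro m
    have h1 : (monomial m.1 (X (i, m)) : FormRing N d) =
        C (X (i, m)) * monomial m.1 1 := by rw [C_mul_monomial, mul_one]
    have h2 : solveAt N d j (monomial m.1 1) = toFrac N d (monomial m.1 1) := by
      rw [monomial_eq, C_1, one_mul, Finsupp.prod, map_prod, map_prod]
      simp
    rw [h1, map_mul, map_mul, h2]
    have h3 : solveAt N d j (C (X (i, m))) =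
      toFrac N d (C (X (i, m))) -
        if m = Mon.pure d j then toFrac N d
          (genericForm N d i) / toFrac N d (X j) ^ d else 0 := by
      simp [solveAt]
    rw [h3, sub_mul]
    congr 1
    split_ifs with hm
    · rw [hm, Mon.pure, ← X_pow_eq_monomial, map_pow]
      exact div_mul_cancel₀ _ (pow_ne_zero _ (algebraMap_X_ne_zero j))
    · simp
  conv_lhs => rw [genericForm, map_sum]
  simp_rw [h]
  rw [Finset.sum_sub_distrib, Finset.sum_ite_eq', if_pos (Finset.mem_univ _), ← map_sum]
  exact sub_self _

theorem solveAt_eq_zero_of_mem {t : FormRing N d}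
    (ht : t ∈ genericIdeal N d) : solveAt N d j t = 0 := by
  have : genericIdeal N d ≤ RingHom.ker (solveAt N d j) := by
    rw [genericIdeal, Ideal.span_le]
    rintro _ ⟨i, rfl⟩
    exact solveAt_genericForm j i
  exact this ht

/-- For every `t` some `X_j ^ k * solveAt t` is a polynomial congruent to `X_j ^ k * t` modulo the
generic forms. -/
theorem exists_sub_mem_and_algebraMap_eq (t : FormRing N d) :
    ∃ (k : ℕ) (s : FormRing N d),
      s - X j ^ k * t ∈ genericIdeal N d ∧
        toFrac N d s = toFrac N d (X j) ^ k * solveAt N d j t := by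
  classical
  have hadd : ∀ t₁ t₂ : FormRing N d,
      (∃ (k : ℕ) (s : FormRing N d),
        s - X j ^ k * t₁ ∈ genericIdeal N d ∧
          toFrac N d s = toFrac N d (X j) ^ k * solveAt N d j t₁) →
      (∃ (k : ℕ) (s : FormRing N d),
        s - X j ^ k * t₂ ∈ genericIdeal N d ∧
          toFrac N d s = toFrac N d (X j) ^ k * solveAt N d j t₂) →
      ∃ (k : ℕ) (s : FormRing N d),
        s - X j ^ k * (t₁ + t₂) ∈ genericIdeal N d ∧
          toFrac N d s = toFrac N d (X j) ^ k * solveAt N d j (t₁ + t₂) := by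
    rintro t₁ t₂ ⟨k₁, s₁, h₁, e₁⟩ ⟨k₂, s₂, h₂, e₂⟩
    refine ⟨k₁ + k₂, X j ^ k₂ * s₁ + X j ^ k₁ * s₂, ?_, ?_⟩
    · have := Ideal.add_mem _ (Ideal.mul_mem_left _ (X j ^ k₂) h₁)
        (Ideal.mul_mem_left _ (X j ^ k₁) h₂)
      convert this using 1
      ring
    · rw [map_add, map_mul, map_mul, e₁, e₂, map_pow, map_pow, map_add]
      ring
  have hmul : ∀ t₁ t₂ : FormRing N d,
      (∃ (k : ℕ) (s : FormRing N d),
        s - X j ^ k * t₁ ∈ genericIdeal N d ∧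
          toFrac N d s = toFrac N d (X j) ^ k * solveAt N d j t₁) →
      (∃ (k : ℕ) (s : FormRing N d),
        s - X j ^ k * t₂ ∈ genericIdeal N d ∧
          toFrac N d s = toFrac N d (X j) ^ k * solveAt N d j t₂) →
      ∃ (k : ℕ) (s : FormRing N d),
        s - X j ^ k * (t₁ * t₂) ∈ genericIdeal N d ∧
          toFrac N d s = toFrac N d (X j) ^ k * solveAt N d j (t₁ * t₂) := by
    rintro t₁ t₂ ⟨k₁, s₁, h₁, e₁⟩ ⟨k₂, s₂, h₂, e₂⟩
    refine ⟨k₁ + k₂, s₁ * s₂, ?_, ?_⟩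
    · have := Ideal.add_mem _ (Ideal.mul_mem_left _ s₂ h₁)
        (Ideal.mul_mem_left _ (X j ^ k₁ * t₁) h₂)
      convert this using 1
      ring
    · rw [map_mul, e₁, e₂, map_mul]
      ring
  have hX : ∀ i, ∃ (k : ℕ) (s : FormRing N d),
        s - X j ^ k * X i ∈ genericIdeal N d ∧
          toFrac N d s = toFrac N d (X j) ^ k * solveAt N d j (X i) :=
    fun i => ⟨0, X i, by simp, by simp⟩
  induction t using MvPolynomial.induction_on with
  | add p q hp hq => exact hadd p q hp hq
  | mul_X p i hp => exact hmul p (X i) hp (hX i)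
  | C c =>
    induction c using MvPolynomial.induction_on with
    | C z => exact ⟨0, C (C z), by simp, by simp [solveAt]⟩
    | add p q hp hq => rw [map_add]; exact hadd _ _ hp hq
    | mul_X p i hp =>
      rw [map_mul]
      refine hmul _ _ hp ?_
      by_cases hi : i.2 = Mon.pure d j
      -- The only coefficients that `solveAt` moves; the factor `X_j ^ d` clears the denominator.
      · refine ⟨d, X j ^ d * C (X i) - genericForm N d i.1, ?_, ?_⟩
        · rw [sub_sub_cancel_left]
          exact neg_mem (Ideal.subset_span ⟨_, rfl⟩)
        · have h0 := pow_ne_zero d (algebraMap_X_ne_zero (N := N) (d := d) j)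
          simp only [solveAt, coe_eval₂Hom, eval₂_C, eval₂_X, if_pos hi, map_sub, map_mul, map_pow,
            mul_sub, mul_div_cancel₀ _ h0]
      · exact ⟨0, C (X i), by simp, by simp [solveAt, hi]⟩

/-- The kernel is the saturation of the generic ideal by `X_j`: clearing denominators in `solveAt t
= 0` leaves a multiple `X_j ^ k * t` congruent to `0`. -/
theorem solveAt_eq_zero_iff (t : FormRing N d) :
    solveAt N d j t = 0 ↔ ∃ k : ℕ, X j ^ k * t ∈ genericIdeal N d := by
  constructor
  · intro h
    obtain ⟨k, s, hs, e⟩ := exists_sub_mem_and_algebraMap_eq j t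
    rw [h, mul_zero, IsFractionRing.to_map_eq_zero_iff] at e
    rw [e, zero_sub, neg_mem_iff] at hs
    exact ⟨k, hs⟩
  · rintro ⟨k, hk⟩
    have := solveAt_eq_zero_of_mem j hk
    rw [map_mul, map_pow, solveAt_X] at this
    exact (mul_eq_zero.1 this).resolve_left (pow_ne_zero _ (algebraMap_X_ne_zero j))

/-- The elimination ideal is determined by any one of the variables. -/
theorem mem_elimIdeal_iff (a : CoeffRing N d) :
    a ∈ elimIdeal N d ↔ solveAt N d j (C a) = 0 := by
  constructor
  · exact fun ha => (solveAt_eq_zero_iff j _).2 (ha j)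
  · intro h i
    obtain ⟨k, hk⟩ := (solveAt_eq_zero_iff j _).1 h
    -- In the field of values of `solveAt` at `i`, the power of `X_j` is invertible and cancels.
    have := solveAt_eq_zero_of_mem i hk
    rw [map_mul, map_pow, solveAt_X] at this
    exact (solveAt_eq_zero_iff i _).1
      ((mul_eq_zero.1 this).resolve_left (pow_ne_zero _ (algebraMap_X_ne_zero j)))

/-- The ideal is the kernel of a ring homomorphism into a field. -/
instance elimIdeal_isPrime : (elimIdeal N d).IsPrime := by
  have : elimIdeal N d = RingHom.ker ((solveAt N d 0).comp C) := by
    ext a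
    rw [mem_elimIdeal_iff 0, RingHom.mem_ker]
    rfl
  rw [this]
  exact RingHom.ker_isPrime _

end

/-! ### The elimination ideal is principal -/

/-- Elements of the elimination ideal vanish at the coefficients of forms with a common zero one of
whose coordinates is `1`. -/
theorem eval_eq_zero_of_mem_elimIdeal {N d : ℕ} {B : Type*} [CommRing B] {a : CoeffRing N d}
    (ha : a ∈ elimIdeal N d) (γ : Fin (N + 1) × Mon N d → B) (x : Fin (N + 1) → B)
    (hx : x 0 = 1) (h : ∀ i, ∑ m : Mon N d, γ (i, m) * m.1.prod (fun j e => x j ^ e) = 0) :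
    eval₂Hom (Int.castRingHom B) γ a = 0 := by
  obtain ⟨k, hk⟩ := ha 0
  have : genericIdeal N d ≤ RingHom.ker (eval₂Hom (eval₂Hom (Int.castRingHom B) γ) x) := by
    rw [genericIdeal, Ideal.span_le]
    rintro _ ⟨i, rfl⟩
    rw [SetLike.mem_coe, RingHom.mem_ker, genericForm, map_sum, ← h i]
    refine Finset.sum_congr rfl fun m _ => ?_
    simp [eval₂_monomial]
  have := this hk
  rw [RingHom.mem_ker, map_mul, map_pow] at this
  simpa [hx] using this

/-- The exponent vector of `X_i * X_0 ^ (d - 1)`. -/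
noncomputable def Mon.lin {N d : ℕ} (hd : 1 ≤ d) (i : Fin (N + 1)) : Mon N d :=
  ⟨Finsupp.single i 1 + Finsupp.single 0 (d - 1), (mem_finsuppAntidiag_univ _).2 (by
    rw [map_add, Finsupp.degree_single, Finsupp.degree_single]; omega)⟩

theorem Mon.lin_ne_pure {N d : ℕ} (hd : 1 ≤ d) {i : Fin (N + 1)} (hi : i ≠ 0) :
    Mon.lin hd i ≠ Mon.pure d 0 := by
  intro h
  have := DFunLike.congr_fun (congrArg Subtype.val h) i
  simp [Mon.lin, Mon.pure, hi.symm] at this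

/-- The ring of polynomials in all generic coefficients but the coefficient of `X_0 ^ d` in the
form with index `0`. -/
abbrev TruncRing (N d : ℕ) : Type :=
  MvPolynomial {p : Fin (N + 1) × Mon N d // p ≠ (0, Mon.pure d 0)} ℤ

theorem exists_eq_X_pow_mul_coeff_zero_ne_zero {A : Type*} [CommRing A] {P : Polynomial A}
    (hP : P ≠ 0) : ∃ (r : ℕ) (Q : Polynomial A), P = Polynomial.X ^ r * Q ∧ Q.coeff 0 ≠ 0 := by
  obtain ⟨Q, hQ, hn⟩ := Polynomial.exists_eq_pow_rootMultiplicity_mul_and_not_dvd P hP 0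
  rw [map_zero, sub_zero] at hQ hn
  exact ⟨_, Q, hQ, fun h => hn (Polynomial.X_dvd_iff.2 h)⟩

/-- No nonzero element of the elimination ideal is free of the coefficient of `X_0 ^ d` in the form
with index `0`. -/
theorem eq_zero_of_rename_mem_elimIdeal {N d : ℕ} (hd : 1 ≤ d)
    (P : TruncRing N d) (hP : rename Subtype.val P ∈ elimIdeal N d) : P = 0 := by
  classical
  -- Deform by a parameter `t`: in the forms with `i ≠ 0`, all coefficients except those of `X_0 ^
  -- d` and `X_i * X_0 ^ (d - 1)` get a factor `t`. At `t = 0` such a form is a two-term one,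
  -- vanishing at `(1, ξ)` for the `ξ` below. For general `t` the coefficients of `X_0 ^ d` are
  -- corrected to `u i` so that `(1, ξ)` remains a common zero.
  by_contra hP0
  let ι : TruncRing N d →+* FractionRing (TruncRing N d) := algebraMap (TruncRing N d) (FractionRing (TruncRing N d))
  -- The value `0` at the excluded index plays no role: there `δ` takes the value `u 0`.
  let c : Fin (N + 1) × Mon N d → FractionRing (TruncRing N d) := fun p =>
    if h : p ≠ (0, Mon.pure d 0) then ι (X ⟨p, h⟩) else 0
  have hc : ∀ p (h : p ≠ (0, Mon.pure d 0)), c p = ι (X ⟨p, h⟩) := fun p h => dif_pos h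
  have hc0 : ∀ p, p ≠ (0, Mon.pure d 0) → c p ≠ 0 := by
    intro p h
    rw [hc p h, Ne, IsFractionRing.to_map_eq_zero_iff]
    exact X_ne_zero _
  let ξ : Fin (N + 1) → FractionRing (TruncRing N d) := fun i =>
    if i = 0 then 1 else -c (i, Mon.pure d 0) / c (i, Mon.lin hd i)
  let w : Fin (N + 1) × Mon N d → Polynomial (FractionRing (TruncRing N d)) := fun p =>
    if p.1 ≠ 0 ∧ p.2 ≠ Mon.pure d 0 ∧ p.2 ≠ Mon.lin hd p.1 then Polynomial.X else 1
  let x : Fin (N + 1) → Polynomial (FractionRing (TruncRing N d)) := fun i => Polynomial.C (ξ i)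
  let xm : Mon N d → Polynomial (FractionRing (TruncRing N d)) := fun m => m.1.prod fun j e => x j ^ e
  let u : Fin (N + 1) → Polynomial (FractionRing (TruncRing N d)) := fun i =>
    -∑ m ∈ Finset.univ.erase (Mon.pure d 0), w (i, m) * Polynomial.C (c (i, m)) * xm m
  let δ : Fin (N + 1) × Mon N d → Polynomial (FractionRing (TruncRing N d)) := fun p =>
    if p.2 = Mon.pure d 0 then u p.1 else Polynomial.C (c p)
  let γ : Fin (N + 1) × Mon N d → Polynomial (FractionRing (TruncRing N d)) := fun p => w p * δ p
  have hx0 : x 0 = 1 := by simp [x, ξ]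
  have hxm : xm (Mon.pure d 0) = 1 := by
    simp only [xm, Mon.pure]
    rw [Finsupp.prod_single_index (h := fun j e => x j ^ e) (pow_zero _), hx0, one_pow]
  have hwp : ∀ i, w (i, Mon.pure d 0) = 1 := fun i => by simp [w]
  have hγ : ∀ i, ∑ m : Mon N d, γ (i, m) * m.1.prod (fun j e => x j ^ e) = 0 := by
    intro i
    rw [← Finset.add_sum_erase _ _ (Finset.mem_univ (Mon.pure d 0))]
    have h1 : γ (i, Mon.pure d 0) * (Mon.pure d 0).1.prod (fun j e => x j ^ e) = u i := by
      change _ * xm (Mon.pure d 0) = _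
      simp [γ, hxm, hwp, δ]
    rw [h1, neg_add_eq_zero]
    refine Finset.sum_congr rfl fun m hm => ?_
    simp [γ, δ, Finset.ne_of_mem_erase hm, xm]
  -- reduction modulo `t`
  have hδ0 : ∀ p, p ≠ (0, Mon.pure d 0) → (δ p).eval 0 = c p := by
    rintro ⟨i, m⟩ hp
    by_cases hm : m = Mon.pure d 0
    · subst hm
      have hi : i ≠ 0 := fun h => hp (by rw [h])
      have hlin : Mon.lin hd i ∈ Finset.univ.erase (Mon.pure d 0) :=
        Finset.mem_erase.2 ⟨Mon.lin_ne_pure hd hi, Finset.mem_univ _⟩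
      have hne : (i, Mon.lin hd i) ≠ ((0, Mon.pure d 0) : Fin (N + 1) × Mon N d) :=
        fun h => hi (congrArg Prod.fst h)
      have hxl : xm (Mon.lin hd i) = Polynomial.C (ξ i) := by
        simp only [xm, Mon.lin]
        rw [Finsupp.prod_add_index' (by simp) (by intros; rw [pow_add])]
        rw [Finsupp.prod_single_index (h := fun j e => x j ^ e) (pow_zero _),
          Finsupp.prod_single_index (h := fun j e => x j ^ e) (pow_zero _), hx0,
          one_pow, mul_one, pow_one]
      simp only [δ, u, if_true, Polynomial.eval_neg, Polynomial.eval_finsetSum]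
      rw [Finset.sum_eq_single_of_mem _ hlin]
      · rw [hxl]
        have := hc0 _ hne
        simp [w, ξ, hi, mul_div_cancel₀ _ this]
      · intro m hm hml
        simp [w, hi, Finset.ne_of_mem_erase hm, hml]
    · simp [δ, hm]
  -- `s` inserts the factors `t`, and `h` inserts the corrected coefficients; together they evaluate
  -- at `γ`. Keeping `t` formal in `s` allows the powers of `t` to be divided out before setting `t
  -- = 0`.
  let s : TruncRing N d →+* Polynomial (TruncRing N d) := eval₂Hom (Int.castRingHom _) fun p =>
    (if p.1.1 ≠ 0 ∧ p.1.2 ≠ Mon.pure d 0 ∧ p.1.2 ≠ Mon.lin hd p.1.1 then Polynomial.X else 1) *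
      Polynomial.C (X p)
  let f : TruncRing N d →+* Polynomial (FractionRing (TruncRing N d)) := eval₂Hom (Int.castRingHom _) fun p => δ p.1
  let h : Polynomial (TruncRing N d) →+* Polynomial (FractionRing (TruncRing N d)) := Polynomial.eval₂RingHom f Polynomial.X
  have hs : s P ≠ 0 := by
    intro h0
    have : (Polynomial.evalRingHom 1).comp s = RingHom.id _ := by
      apply MvPolynomial.ringHom_ext
      · intro z; simp [s]
      · intro p
        simp only [s, RingHom.comp_apply, coe_eval₂Hom, eval₂_X, map_mul]
        split_ifs <;> simp
    have h2 := DFunLike.congr_fun this P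
    rw [RingHom.comp_apply, h0, map_zero] at h2
    exact hP0 h2.symm
  have hhs : h.comp s = (eval₂Hom (Int.castRingHom _) γ).comp (rename Subtype.val).toRingHom := by
    apply MvPolynomial.ringHom_ext
    · intro z; simp [s, h]
    · intro p
      simp only [s, h, RingHom.comp_apply, coe_eval₂Hom, eval₂_X, map_mul, γ, w]
      split_ifs <;> simp_all [f]
  have hf0 : (Polynomial.evalRingHom 0).comp f = ι := by
    apply MvPolynomial.ringHom_ext
    · intro z; simp [f, ι]
    · intro p
      simp only [f, RingHom.comp_apply, coe_eval₂Hom, eval₂_X, Polynomial.coe_evalRingHom]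
      rw [hδ0 _ p.2, hc _ p.2]
  obtain ⟨r, Q, hQ, hQ0⟩ := exists_eq_X_pow_mul_coeff_zero_ne_zero hs
  have hz : h (s P) = 0 := by
    have := DFunLike.congr_fun hhs P
    exact this.trans (eval_eq_zero_of_mem_elimIdeal hP γ x hx0 hγ)
  rw [hQ, map_mul, map_pow] at hz
  have hX : h Polynomial.X = Polynomial.X := by simp [h]
  rw [hX] at hz
  have hhQ : h Q = 0 := (mul_eq_zero.1 hz).resolve_left (pow_ne_zero _ Polynomial.X_ne_zero)
  -- At `t = 0` the corrected coefficients are again independent variables, so the lowest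
  -- coefficient of `s P` in `t` would have to vanish.
  have hev : Polynomial.evalRingHom 0 (h Q) = ι (Q.coeff 0) := by
    simp only [h, Polynomial.coe_eval₂RingHom]
    rw [Polynomial.hom_eval₂, hf0]
    simp [Polynomial.eval₂_at_zero]
  rw [hhQ, map_zero, eq_comm, IsFractionRing.to_map_eq_zero_iff] at hev
  exact hQ0 hev

/-! ### Existence of the resultant -/

/-- The Macaulay resultant exists. -/
theorem exists_isMacaulayResultant {N d : ℕ} (hd : 1 ≤ d) : ∃ R, IsMacaulayResultant N d R := by
  classical
  -- `ℤ[c]` as polynomials in the coefficient of `X_0 ^ d` in the form with index `0`, over the ring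
  -- of the others.
  let E : CoeffRing N d ≃+* Polynomial (TruncRing N d) :=
    ((renameEquiv ℤ (Equiv.optionSubtypeNe
      ((0, Mon.pure d 0) : Fin (N + 1) × Mon N d)).symm).trans
        (optionEquivLeft ℤ _)).toRingEquiv
  have hE : ∀ P, E.symm (Polynomial.C P) = rename Subtype.val P := by
    intro P
    rw [RingEquiv.symm_apply_eq]
    change Polynomial.C P = optionEquivLeft ℤ _ (renameEquiv ℤ _ (rename Subtype.val P))
    induction P using MvPolynomial.induction_on with
    | C z => simp
    | add p q hp hq => simp only [map_add, hp, hq]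
    | mul_X p i hp =>
      simp only [map_mul, hp]
      congr 1
      simp [Equiv.optionSubtypeNe_symm_of_ne i.2]
  have hprime : ((elimIdeal N d).comap E.symm.toRingHom).IsPrime :=
    Ideal.comap_isPrime _ _
  obtain ⟨f, hf⟩ := exists_span_singleton_eq_of_comap_C_eq_bot
    ((elimIdeal N d).comap E.symm.toRingHom) (by
      rw [eq_bot_iff]
      intro P hP
      refine eq_zero_of_rename_mem_elimIdeal hd P ?_
      rw [← hE]
      exact hP)
  have hg : Ideal.span {E.symm f} = elimIdeal N d := by
    ext a
    have h1 : E a ∈ Ideal.span {f} ↔ E.symm (E a) ∈ elimIdeal N d := SetLike.ext_iff.1 hf (E a)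
    rw [Ideal.mem_span_singleton, RingEquiv.symm_apply_apply] at h1
    rw [Ideal.mem_span_singleton, ← h1, ← map_dvd_iff E, RingEquiv.apply_symm_apply]
  -- the value at the pure powers is not divisible by any prime number
  have hunit : IsUnit (eval (purePowerCoeff N d) (E.symm f)) := by
    by_contra hu
    obtain ⟨q, hq, hqd⟩ := Int.exists_prime_and_dvd (mt Int.isUnit_iff_natAbs_eq.2 hu)
    have hq' := Int.prime_iff_natAbs_prime.1 hq
    have : Fact q.natAbs.Prime := ⟨hq'⟩
    -- The generator divides `a`, which is nonzero modulo `q` at the pure powers.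
    obtain ⟨a, ha, ha0⟩ := exists_mem_elimIdeal_specialize_ne_zero (k := ZMod q.natAbs) (d := d)
      (Ψ := fun i : Fin (N + 1) => X i ^ d) (fun i => isHomogeneous_X_pow i d)
      (fun j => ⟨d, Ideal.subset_span ⟨j, rfl⟩⟩)
    rw [← hg, Ideal.mem_span_singleton] at ha
    have hspec : specialize d (fun i : Fin (N + 1) => (X i ^ d : MvPolynomial _ (ZMod q.natAbs))) =
        (Int.castRingHom _).comp (eval (purePowerCoeff N d)) := by
      apply MvPolynomial.ringHom_ext
      · intro z; simp [specialize]
      · intro p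
        simp [specialize, purePowerCoeff, coeff_X_pow, eq_comm]
    apply ha0
    have h1 : specialize d (fun i : Fin (N + 1) => (X i ^ d : MvPolynomial _ (ZMod q.natAbs)))
        (E.symm f) = 0 := by
      rw [hspec, RingHom.comp_apply, eq_intCast, ZMod.intCast_zmod_eq_zero_iff_dvd]
      simpa using hqd
    exact zero_dvd_iff.1 (h1 ▸ map_dvd _ ha)
  rcases Int.isUnit_iff.1 hunit with h1 | h1
  · exact ⟨_, hg, h1⟩
  · exact ⟨-E.symm f, by rw [Ideal.span_singleton_neg, hg], by rw [map_neg, h1, neg_neg]⟩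

theorem resultantPoly_spec {N d : ℕ} (hd : 1 ≤ d) : IsMacaulayResultant N d (resultantPoly N d) :=
  Classical.epsilon_spec (exists_isMacaulayResultant hd)

theorem eval_smul_of_isHomogeneous {σ A : Type*} [Fintype σ] [CommRing A] {P : MvPolynomial σ A}
    {n : ℕ} (hP : P.IsHomogeneous n) (c : A) (x : σ → A) :
    eval (c • x) P = c ^ n * eval x P := by
  rw [eval_eq', eval_eq', Finset.mul_sum]
  refine Finset.sum_congr rfl fun m hm => ?_
  have hdeg : m.degree = n := hP.degree_eq_sum_deg_support hm ▸ rfl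
  simp only [Pi.smul_apply, smul_eq_mul, mul_pow, Finset.prod_mul_distrib]
  rw [Finset.prod_pow_eq_pow_sum, ← Finsupp.degree_eq_sum, hdeg]
  ring

/-! ### Lifts and their normalization -/

section Lifts

variable {K : Type*} [NontriviallyNormedField K] {N d : ℕ}

theorem polyMap_smul {Φ : Fin (N + 1) → MvPolynomial (Fin (N + 1)) K}
    (hΦ : ∀ i, (Φ i).IsHomogeneous d) (c : K) (x : Fin (N + 1) → K) :
    polyMap Φ (c • x) = c ^ d • polyMap Φ x :=
  funext fun i => eval_smul_of_isHomogeneous (hΦ i) c x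

/-- Hilbert's Nullstellensatz: `X_j` vanishes at the origin, the only possible common zero. -/
theorem exists_X_pow_mem_span [IsAlgClosed K] {Ψ : Fin (N + 1) → MvPolynomial (Fin (N + 1)) K}
    (hΨ : ∀ x : Fin (N + 1) → K, x ≠ 0 → polyMap Ψ x ≠ 0) (j : Fin (N + 1)) :
    ∃ l, (X j : MvPolynomial (Fin (N + 1)) K) ^ l ∈ Ideal.span (Set.range Ψ) := by
  suffices X j ∈ (Ideal.span (Set.range Ψ)).radical from this
  rw [← vanishingIdeal_zeroLocus_eq_radical (K := K), mem_vanishingIdeal_iff]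
  intro x hx
  rw [zeroLocus_span] at hx
  have : x = 0 := by
    by_contra h
    exact hΨ x h (funext fun i => hx _ ⟨i, rfl⟩)
  simp [this]

/-- The resultant polynomial divides an element of the elimination ideal that is nonzero at `Ψ`. -/
theorem resultant_ne_zero [IsAlgClosed K] (hd : 1 ≤ d)
    {Ψ : Fin (N + 1) → MvPolynomial (Fin (N + 1)) K} (hhom : ∀ i, (Ψ i).IsHomogeneous d)
    (hΨ : ∀ x : Fin (N + 1) → K, x ≠ 0 → polyMap Ψ x ≠ 0) : resultant d Ψ ≠ 0 := by
  obtain ⟨a, ha, ha0⟩ := exists_mem_elimIdeal_specialize_ne_zero hhom (exists_X_pow_mem_span hΨ)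
  rw [← (resultantPoly_spec hd).1, Ideal.mem_span_singleton] at ha
  intro h
  rw [resultant_eq_specialize] at h
  exact ha0 (zero_dvd_iff.1 (h ▸ map_dvd (specialize d Ψ) ha))

/-- Two lifts of the same degree of a map are proportional. -/
theorem IsLift.exists_polyMap_eq_smul [IsAlgClosed K] (hd : 1 ≤ d)
    {φ : ℙ K (Fin (N + 1) → K) → ℙ K (Fin (N + 1) → K)}
    {Φ Ψ : Fin (N + 1) → MvPolynomial (Fin (N + 1)) K} (hΦ : IsLift d φ Φ) (hΨ : IsLift d φ Ψ) :
    ∃ c : K, c ≠ 0 ∧ ∀ x, polyMap Φ x = c • polyMap Ψ x := by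
  have hpt : ∀ x : Fin (N + 1) → K, x ≠ 0 → ∃ c : K, polyMap Φ x = c • polyMap Ψ x := by
    intro x hx
    have := (hΦ.map_mk x hx).symm.trans (hΨ.map_mk x hx)
    rw [Projectivization.mk_eq_mk_iff'] at this
    obtain ⟨c, hc⟩ := this
    exact ⟨c, hc.symm⟩
  suffices ∃ c : K, ∀ x, polyMap Φ x = c • polyMap Ψ x by
    obtain ⟨c, hc⟩ := this
    refine ⟨c, ?_, hc⟩
    rintro rfl
    refine hΦ.ne_zero 1 one_ne_zero ?_
    rw [hc, zero_smul]
  -- The divisibility argument below needs two variables; for `N = 0` every vector is a multiple of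
  -- `1`.
  rcases Nat.eq_zero_or_pos N with rfl | hN
  · obtain ⟨c, hc⟩ := hpt 1 one_ne_zero
    refine ⟨c, fun x => ?_⟩
    have hx : x = x 0 • (1 : Fin (0 + 1) → K) := by
      ext i
      rw [show i = 0 from Fin.fin_one_eq_zero i]
      simp
    rw [hx, polyMap_smul hΦ.isHomogeneous, polyMap_smul hΨ.isHomogeneous, hc, smul_comm]
  have hcross : ∀ i l, Φ i * Ψ l = Φ l * Ψ i := by
    intro i l
    apply MvPolynomial.funext
    intro x
    by_cases hx : x = 0
    · have h0 : ∀ i, eval x (Φ i) = 0 := fun i => by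
        have := eval_smul_of_isHomogeneous (hΦ.isHomogeneous i) 0 x
        rwa [zero_pow (by omega), zero_mul, zero_smul, ← hx] at this
      simp [h0]
    · obtain ⟨c, hc⟩ := hpt x hx
      have h1 : ∀ i, eval x (Φ i) = c * eval x (Ψ i) := fun i => congrFun hc i
      rw [map_mul, map_mul, h1, h1]
      ring
  -- Multiply `X_j ^ k = ∑ b_i Ψ_i` by `Φ_l` and use the cross relations.
  have hquot : ∀ j, ∃ (k : ℕ) (B : MvPolynomial (Fin (N + 1)) K),
      ∀ l, X j ^ k * Φ l = Ψ l * B := by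
    intro j
    obtain ⟨k, hk⟩ := exists_X_pow_mem_span hΨ.ne_zero j
    obtain ⟨b, hb⟩ := Ideal.mem_span_range_iff_exists_fun.1 hk
    refine ⟨k, ∑ i, b i * Φ i, fun l => ?_⟩
    rw [← hb, Finset.sum_mul, Finset.mul_sum]
    refine Finset.sum_congr rfl fun i _ => ?_
    rw [mul_assoc, mul_comm (Ψ i), hcross l i]
    ring
  have hex : ∃ l, Φ l ≠ 0 := by
    by_contra! h
    exact hΦ.ne_zero 1 one_ne_zero (funext fun i => by simp [polyMap, h])
  obtain ⟨l, hl⟩ := hex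
  set j₁ : Fin (N + 1) := ⟨1, by omega⟩
  have hj : (0 : Fin (N + 1)) ≠ j₁ := by simp [j₁, Fin.ext_iff]
  obtain ⟨k₀, B₀, h₀⟩ := hquot 0
  obtain ⟨k₁, B₁, h₁⟩ := hquot j₁
  have hΨl : Ψ l ≠ 0 := by
    intro h
    have := h₀ l
    rw [h, zero_mul] at this
    exact (mul_ne_zero (pow_ne_zero _ (X_ne_zero 0)) hl) this
  have hBB : B₀ * X j₁ ^ k₁ = X 0 ^ k₀ * B₁ := by
    apply mul_left_cancel₀ hΨl
    calc Ψ l * (B₀ * X j₁ ^ k₁) = Ψ l * B₀ * X j₁ ^ k₁ := by ring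
      _ = X 0 ^ k₀ * (X j₁ ^ k₁ * Φ l) := by rw [← h₀]; ring
      _ = Ψ l * (X 0 ^ k₀ * B₁) := by rw [h₁]; ring
  -- Comparing two variables removes the denominator: `X_0` is prime and does not divide `X_{j₁}`.
  have hdvd : (X 0 : MvPolynomial (Fin (N + 1)) K) ^ k₀ ∣ B₀ := by
    refine (X_prime (i := (0 : Fin (N + 1)))).pow_dvd_of_dvd_mul_right k₀ (b := X j₁ ^ k₁) ?_
      ⟨B₁, hBB⟩
    intro h
    exact hj (X_dvd_X.1 ((X_prime (i := (0 : Fin (N + 1)))).dvd_of_dvd_pow h))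
  obtain ⟨g, rfl⟩ := hdvd
  have hg : ∀ i, Φ i = Ψ i * g := by
    intro i
    apply mul_left_cancel₀ (pow_ne_zero k₀ (X_ne_zero (R := K) (0 : Fin (N + 1))))
    rw [h₀ i]
    ring
  have hg0 : g ≠ 0 := by
    rintro rfl
    exact hl (by rw [hg l, mul_zero])
  have hdeg : g.totalDegree = 0 := by
    have h1 := totalDegree_mul_of_isDomain hΨl hg0
    rw [← hg l, (hΦ.isHomogeneous l).totalDegree hl, (hΨ.isHomogeneous l).totalDegree hΨl] at h1
    omega
  refine ⟨g.coeff 0, fun x => funext fun i => ?_⟩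
  change eval x (Φ i) = g.coeff 0 * eval x (Ψ i)
  rw [hg i, totalDegree_eq_zero_iff_eq_C.1 hdeg, map_mul, eval_C, coeff_C, if_pos rfl, mul_comm]

theorem gFun_mk (hd : 1 ≤ d) {Φ : Fin (N + 1) → MvPolynomial (Fin (N + 1)) K}
    (hhom : ∀ i, (Φ i).IsHomogeneous d)
    (h0 : ∀ x : Fin (N + 1) → K, x ≠ 0 → polyMap Φ x ≠ 0) (x : Fin (N + 1) → K) (hx : x ≠ 0) :
    gFun d Φ (Projectivization.mk K x hx) =
      1 / (d : ℝ) * Real.log ‖polyMap Φ x‖ - Real.log ‖x‖ := by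
  obtain ⟨a, ha⟩ := Projectivization.exists_smul_eq_mk_rep K x hx
  have ha0 : ‖(a : K)‖ ≠ 0 := norm_ne_zero_iff.2 a.ne_zero
  have hd0 : (d : ℝ) ≠ 0 := by positivity
  rw [gFun, ← ha, Units.smul_def, polyMap_smul hhom, norm_smul, norm_smul, norm_pow,
    Real.log_mul (pow_ne_zero _ ha0) (norm_ne_zero_iff.2 (h0 x hx)),
    Real.log_mul ha0 (norm_ne_zero_iff.2 hx), Real.log_pow]
  field_simp
  ring

/-- Divide by a coefficient of largest absolute value. -/
theorem IsLift.exists_isMinimalLift {φ : ℙ K (Fin (N + 1) → K) → ℙ K (Fin (N + 1) → K)}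
    {Φ : Fin (N + 1) → MvPolynomial (Fin (N + 1)) K} (hΦ : IsLift d φ Φ) :
    ∃ Ψ, IsMinimalLift d φ Ψ := by
  have : Nonempty (Fin (N + 1) × Mon N d) := ⟨(0, Mon.pure d 0)⟩
  obtain ⟨p, hp⟩ := Finite.exists_max fun q : Fin (N + 1) × Mon N d => ‖(Φ q.1).coeff q.2.1‖
  have hmax : ∀ i m, ‖(Φ i).coeff m‖ ≤ ‖(Φ p.1).coeff p.2.1‖ := by
    intro i m
    by_cases hm : m.degree = d
    · exact hp (i, ⟨m, (mem_finsuppAntidiag_univ m).2 hm⟩)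
    · rw [(hΦ.isHomogeneous i).coeff_eq_zero hm, norm_zero]
      exact norm_nonneg _
  set b := (Φ p.1).coeff p.2.1 with hb
  have hb0 : b ≠ 0 := by
    intro h
    refine hΦ.ne_zero 1 one_ne_zero (funext fun i => ?_)
    have : Φ i = 0 := by
      ext m
      have := hmax i m
      rw [h, norm_zero, norm_le_zero_iff] at this
      simpa using this
    simp [polyMap, this]
  have hbn : ‖b‖ ≠ 0 := norm_ne_zero_iff.2 hb0
  have hmap : ∀ x, polyMap (fun i => C b⁻¹ * Φ i) x = b⁻¹ • polyMap Φ x := by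
    intro x
    ext i
    simp [polyMap]
  refine ⟨fun i => C b⁻¹ * Φ i, ⟨⟨fun i => (hΦ.isHomogeneous i).C_mul _, fun x hx => ?_,
    fun x hx => ?_⟩, fun i m => ?_, p.1, p.2.1, ?_⟩⟩
  · rw [hmap]
    exact smul_ne_zero (inv_ne_zero hb0) (hΦ.ne_zero x hx)
  · rw [hΦ.map_mk x hx, Projectivization.mk_eq_mk_iff']
    exact ⟨b, by rw [hmap, smul_inv_smul₀ hb0]⟩
  · rw [coeff_C_mul, norm_mul, norm_inv]
    exact inv_mul_le_one_of_le₀ (hmax i m) (norm_nonneg _)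
  · rw [coeff_C_mul, ← hb, inv_mul_cancel₀ hb0, norm_one]

theorem exists_mk_eq_norm_eq_one (P : ℙ K (Fin (N + 1) → K)) :
    ∃ (x : Fin (N + 1) → K) (hx : x ≠ 0) (i : Fin (N + 1)),
      P = Projectivization.mk K x hx ∧ ‖x‖ = 1 ∧ x i = 1 := by
  obtain ⟨i, hi⟩ := Finite.exists_max fun j => ‖P.rep j‖
  have h1 : ‖P.rep i‖ = ‖P.rep‖ := le_antisymm (norm_le_pi_norm _ i)
    ((pi_norm_le_iff_of_nonneg (norm_nonneg _)).2 hi)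
  have h0 : P.rep i ≠ 0 := by
    rw [← norm_ne_zero_iff, h1, norm_ne_zero_iff]
    exact P.rep_nonzero
  refine ⟨(P.rep i)⁻¹ • P.rep, smul_ne_zero (inv_ne_zero h0) P.rep_nonzero, i, ?_, ?_, ?_⟩
  · conv_lhs => rw [← P.mk_rep]
    rw [Projectivization.mk_eq_mk_iff']
    exact ⟨P.rep i, smul_inv_smul₀ h0 _⟩
  · rw [norm_smul, norm_inv, h1, inv_mul_cancel₀ (norm_ne_zero_iff.2 P.rep_nonzero)]
  · simp [h0]

end Lifts

/-! ### Ultrametric estimates on the unit sphere -/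

section Ultrametric

variable {K : Type*} [NontriviallyNormedField K] [IsUltrametricDist K] {N d : ℕ}

/-- The closed unit ball of `K` is a subring. -/
theorem norm_eval₂_le_one {σ R : Type*} [CommRing R] (f : R →+* K) (hf : ∀ r, ‖f r‖ ≤ 1)
    (x : σ → K) (hx : ∀ i, ‖x i‖ ≤ 1) (P : MvPolynomial σ R) : ‖eval₂Hom f x P‖ ≤ 1 := by
  induction P using MvPolynomial.induction_on with
  | C r => simpa using hf r
  | add p q hp hq =>
    rw [map_add]
    exact (IsUltrametricDist.norm_add_le_max _ _).trans (max_le hp hq)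
  | mul_X p i hp =>
    rw [map_mul, norm_mul, eval₂Hom_X']
    exact mul_le_one₀ hp (norm_nonneg _) (hx i)

/-- Integral forms have values of absolute value at least `|Res|` on the unit sphere. -/
theorem norm_resultant_le_norm_polyMap (hd : 1 ≤ d)
    {Ψ : Fin (N + 1) → MvPolynomial (Fin (N + 1)) K} (hhom : ∀ i, (Ψ i).IsHomogeneous d)
    (hint : ∀ i m, ‖(Ψ i).coeff m‖ ≤ 1) (x : Fin (N + 1) → K) (hx : ‖x‖ = 1) :
    ‖resultant d Ψ‖ ≤ ‖polyMap Ψ x‖ := by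
  have hmem : resultantPoly N d ∈ elimIdeal N d := by
    rw [← (resultantPoly_spec hd).1]
    exact Ideal.mem_span_singleton_self _
  obtain ⟨j, hj⟩ : ∃ j, ‖x j‖ = ‖x‖ := by
    obtain ⟨j, hj⟩ := Finite.exists_max fun j => ‖x j‖
    exact ⟨j, le_antisymm (norm_le_pi_norm x j)
      ((pi_norm_le_iff_of_nonneg (norm_nonneg _)).2 hj)⟩
  have hxi : ∀ i, ‖x i‖ ≤ 1 := fun i => hx ▸ norm_le_pi_norm x i
  obtain ⟨k, hk⟩ := hmem j
  obtain ⟨b, hb⟩ := Ideal.mem_span_range_iff_exists_fun.1 hk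
  have hF : ∀ i, eval₂Hom (specialize d Ψ) x (genericForm N d i) = polyMap Ψ x i := by
    intro i
    rw [polyMap, ← map_specialize_genericForm hhom i, eval_map]
    rfl
  have hspec : ∀ r, ‖specialize d Ψ r‖ ≤ 1 := fun r =>
    norm_eval₂_le_one (algebraMap ℤ K) (fun z => by
      simpa using IsUltrametricDist.norm_intCast_le_one K z) _ (fun p => hint _ _) r
  -- Evaluate the elimination relation at `Ψ` and `x`: since `|x_j| = 1`, the side with `X_j ^ k`
  -- has absolute value `|Res|`.
  have h1 := congrArg (fun P => ‖eval₂Hom (specialize d Ψ) x P‖) hb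
  simp only [map_sum, map_mul, map_pow, eval₂Hom_X', eval₂Hom_C, hF, norm_mul, norm_pow, hj, hx,
    one_pow, one_mul] at h1
  rw [resultant_eq_specialize, ← h1]
  refine IsUltrametricDist.norm_sum_le_of_forall_le_of_nonneg (norm_nonneg _) fun i _ => ?_
  rw [norm_mul]
  exact (mul_le_of_le_one_left (norm_nonneg _) (norm_eval₂_le_one _ hspec x hxi _)).trans
    (norm_le_pi_norm (polyMap Ψ x) i)

/-- The pairs satisfying the three bounds form a submonoid of `K × K`, by `aa' - bb' = a(a' - b') +
(a - b)b'`, and it contains the pairs of coordinates. -/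
theorem norm_monomial_sub_le {x y : Fin (N + 1) → K} (hx : ‖x‖ ≤ 1) (hy : ‖y‖ ≤ 1)
    (m : Fin (N + 1) →₀ ℕ) :
    ‖∏ i, x i ^ m i‖ ≤ 1 ∧ ‖∏ i, y i ^ m i‖ ≤ 1 ∧
      ‖∏ i, x i ^ m i - ∏ i, y i ^ m i‖ ≤ ‖x - y‖ := by
  let S : Submonoid (K × K) :=
    { carrier := {p | ‖p.1‖ ≤ 1 ∧ ‖p.2‖ ≤ 1 ∧ ‖p.1 - p.2‖ ≤ ‖x - y‖}
      one_mem' := by simp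
      mul_mem' := by
        rintro ⟨a, b⟩ ⟨a', b'⟩ ⟨h1, h2, h3⟩ ⟨h1', h2', h3'⟩
        refine ⟨?_, ?_, ?_⟩
        · exact (norm_mul a a').trans_le (mul_le_one₀ h1 (norm_nonneg _) h1')
        · exact (norm_mul b b').trans_le (mul_le_one₀ h2 (norm_nonneg _) h2')
        · change ‖a * a' - b * b'‖ ≤ _
          rw [show a * a' - b * b' = a * (a' - b') + (a - b) * b' by ring]
          refine (IsUltrametricDist.norm_add_le_max _ _).trans (max_le ?_ ?_)
          · rw [norm_mul]
            exact (mul_le_of_le_one_left (norm_nonneg _) h1).trans h3'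
          · rw [norm_mul]
            exact (mul_le_of_le_one_right (norm_nonneg _) h2').trans h3 }
  have hS : ∀ i, (x i, y i) ∈ S := fun i =>
    ⟨(norm_le_pi_norm x i).trans hx, (norm_le_pi_norm y i).trans hy, norm_le_pi_norm (x - y) i⟩
  have : ∏ i, (x i, y i) ^ m i ∈ S := S.prod_mem fun i _ => S.pow_mem (hS i) _
  have h2 : ∏ i, (x i, y i) ^ m i = (∏ i, x i ^ m i, ∏ i, y i ^ m i) := by
    ext <;> simp [Prod.fst_prod, Prod.snd_prod]
  rw [h2] at this
  exact this

theorem norm_polyMap_le_one {Ψ : Fin (N + 1) → MvPolynomial (Fin (N + 1)) K}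
    (hint : ∀ i m, ‖(Ψ i).coeff m‖ ≤ 1) {x : Fin (N + 1) → K} (hx : ‖x‖ ≤ 1) :
    ‖polyMap Ψ x‖ ≤ 1 := by
  refine (pi_norm_le_iff_of_nonneg zero_le_one).2 fun i => ?_
  rw [polyMap, eval_eq']
  refine IsUltrametricDist.norm_sum_le_of_forall_le_of_nonneg zero_le_one fun m _ => ?_
  rw [norm_mul]
  exact mul_le_one₀ (hint i m) (norm_nonneg _) (norm_monomial_sub_le hx hx m).1

theorem norm_polyMap_sub_le {Ψ : Fin (N + 1) → MvPolynomial (Fin (N + 1)) K}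
    (hint : ∀ i m, ‖(Ψ i).coeff m‖ ≤ 1) {x y : Fin (N + 1) → K} (hx : ‖x‖ ≤ 1) (hy : ‖y‖ ≤ 1) :
    ‖polyMap Ψ x - polyMap Ψ y‖ ≤ ‖x - y‖ := by
  refine (pi_norm_le_iff_of_nonneg (norm_nonneg _)).2 fun i => ?_
  rw [Pi.sub_apply, polyMap, polyMap, eval_eq', eval_eq', ← Finset.sum_sub_distrib]
  refine IsUltrametricDist.norm_sum_le_of_forall_le_of_nonneg (norm_nonneg _) fun m _ => ?_
  rw [← mul_sub, norm_mul]
  exact (mul_le_of_le_one_left (norm_nonneg _) (hint i m)).trans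
    (norm_monomial_sub_le hx hy m).2.2

/-- Points at chordal distance less than `1` have lifts on the unit sphere at distance at most the
chordal distance. -/
theorem exists_mk_eq_norm_sub_le {P Q : ℙ K (Fin (N + 1) → K)} (h : chordalDist P Q < 1) :
    ∃ (x y : Fin (N + 1) → K) (hx : x ≠ 0) (hy : y ≠ 0), P = Projectivization.mk K x hx ∧
      Q = Projectivization.mk K y hy ∧ ‖x‖ = 1 ∧ ‖y‖ = 1 ∧ ‖x - y‖ ≤ chordalDist P Q := by
  obtain ⟨x, hx, i, rfl, hx1, hxi⟩ := exists_mk_eq_norm_eq_one P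
  obtain ⟨y, hy, j, rfl, hy1, hyj⟩ := exists_mk_eq_norm_eq_one Q
  have hD : ∀ a b, ‖x a * y b - x b * y a‖ ≤
      chordalDist (Projectivization.mk K x hx) (Projectivization.mk K y hy) := by
    intro a b
    rw [chordalDist_mk, hx1, hy1, mul_one, div_one]
    exact le_ciSup (f := fun p : Fin (N + 1) × Fin (N + 1) => ‖x p.1 * y p.2 - x p.2 * y p.1‖)
      (Set.finite_range _).bddAbove (a, b)
  -- Otherwise `x_i y_j - x_j y_i = 1 - x_j y_i` has absolute value `1`, against `Δ < 1`. So both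
  -- points can be scaled to have `i`-th coordinate `1`, and the coordinate differences become 2×2
  -- minors up to units.
  have hyi : ‖y i‖ = 1 := by
    refine le_antisymm (hy1 ▸ norm_le_pi_norm y i) ?_
    by_contra! hlt
    have h1 := (hD i j).trans_lt h
    rw [hxi, hyj, one_mul] at h1
    have h2 : ‖x j * y i‖ < 1 := by
      rw [norm_mul]
      exact (mul_le_of_le_one_left (norm_nonneg _) (hx1 ▸ norm_le_pi_norm x j)).trans_lt hlt
    have h3 := IsUltrametricDist.norm_add_le_max (1 - x j * y i) (x j * y i)
    rw [sub_add_cancel, norm_one] at h3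
    exact absurd h3 (not_le.2 (max_lt h1 h2))
  have hyi0 : y i ≠ 0 := by
    rw [← norm_ne_zero_iff, hyi]
    exact one_ne_zero
  refine ⟨x, (y i)⁻¹ • y, hx, smul_ne_zero (inv_ne_zero hyi0) hy, rfl, ?_, hx1, ?_, ?_⟩
  · rw [Projectivization.mk_eq_mk_iff']
    exact ⟨y i, smul_inv_smul₀ hyi0 _⟩
  · rw [norm_smul, norm_inv, hyi, hy1, inv_one, one_mul]
  · refine (pi_norm_le_iff_of_nonneg ((norm_nonneg _).trans (hD i i))).2 fun l => ?_
    refine le_trans (le_of_eq ?_) (hD l i)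
    rw [hxi, one_mul, Pi.sub_apply, Pi.smul_apply, smul_eq_mul,
      show x l - (y i)⁻¹ * y l = (y i)⁻¹ * (x l * y i - y l) by field_simp, norm_mul, norm_inv,
      hyi, inv_one, one_mul]

/-- The values of `Ψ` at suitable unit representatives differ by less than `|Res|`, hence by less
than their own norms, so the norms agree. -/
theorem gFun_eq_of_chordalDist_lt (hd : 1 ≤ d)
    {Ψ : Fin (N + 1) → MvPolynomial (Fin (N + 1)) K} (hhom : ∀ i, (Ψ i).IsHomogeneous d)
    (h0 : ∀ x : Fin (N + 1) → K, x ≠ 0 → polyMap Ψ x ≠ 0)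
    (hint : ∀ i m, ‖(Ψ i).coeff m‖ ≤ 1) {P Q : ℙ K (Fin (N + 1) → K)}
    (h : chordalDist P Q < ‖resultant d Ψ‖) : gFun d Ψ P = gFun d Ψ Q := by
  have hρ : ‖resultant d Ψ‖ ≤ 1 := by
    obtain ⟨x, -, -, -, hx1, -⟩ := exists_mk_eq_norm_eq_one P
    exact (norm_resultant_le_norm_polyMap hd hhom hint x hx1).trans
      (norm_polyMap_le_one hint hx1.le)
  obtain ⟨x, y, hx, hy, hP, hQ, hx1, hy1, hxy⟩ := exists_mk_eq_norm_sub_le (h.trans_le hρ)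
  have hlt : ‖polyMap Ψ x - polyMap Ψ y‖ < ‖resultant d Ψ‖ :=
    ((norm_polyMap_sub_le hint hx1.le hy1.le).trans hxy).trans_lt h
  have heq : ‖polyMap Ψ x‖ = ‖polyMap Ψ y‖ := by
    have h1 := norm_resultant_le_norm_polyMap hd hhom hint x hx1
    have h2 : ‖polyMap Ψ x + -polyMap Ψ y‖ < max ‖polyMap Ψ x‖ ‖-polyMap Ψ y‖ := by
      rw [← sub_eq_add_neg]
      exact hlt.trans_le (h1.trans (le_max_left _ _))
    simpa using IsUltrametricDist.norm_eq_of_add_norm_lt_max h2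
  rw [hP, hQ, gFun_mk hd hhom h0, gFun_mk hd hhom h0, heq, hx1, hy1]

theorem abs_gFun_sub_le (hd : 1 ≤ d)
    {Ψ : Fin (N + 1) → MvPolynomial (Fin (N + 1)) K} (hhom : ∀ i, (Ψ i).IsHomogeneous d)
    (h0 : ∀ x : Fin (N + 1) → K, x ≠ 0 → polyMap Ψ x ≠ 0)
    (hint : ∀ i m, ‖(Ψ i).coeff m‖ ≤ 1) (hρ : resultant d Ψ ≠ 0) (P Q : ℙ K (Fin (N + 1) → K)) :
    |gFun d Ψ P - gFun d Ψ Q| ≤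
      Real.log (‖resultant d Ψ‖⁻¹) / (d * ‖resultant d Ψ‖) * chordalDist P Q := by
  have hρ0 : 0 < ‖resultant d Ψ‖ := norm_pos_iff.2 hρ
  have hd0 : (0 : ℝ) < d := by positivity
  have hbd : ∀ P, Real.log ‖resultant d Ψ‖ / d ≤ gFun d Ψ P ∧ gFun d Ψ P ≤ 0 := by
    intro P
    obtain ⟨x, hx, -, rfl, hx1, -⟩ := exists_mk_eq_norm_eq_one P
    rw [gFun_mk hd hhom h0, hx1, Real.log_one, sub_zero, one_div_mul_eq_div]
    constructor
    · gcongr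
      exact norm_resultant_le_norm_polyMap hd hhom hint x hx1
    · exact div_nonpos_of_nonpos_of_nonneg
        (Real.log_nonpos (norm_nonneg _) (norm_polyMap_le_one hint hx1.le)) hd0.le
  have hlog : 0 ≤ Real.log (‖resultant d Ψ‖⁻¹) / d := by
    rw [Real.log_inv, neg_div]
    linarith [hbd P]
  have hD : 0 ≤ chordalDist P Q :=
    div_nonneg (Real.iSup_nonneg fun _ => norm_nonneg _) (by positivity)
  rw [← div_div, div_mul_eq_mul_div, mul_div_assoc]
  by_cases h : chordalDist P Q < ‖resultant d Ψ‖
  · rw [gFun_eq_of_chordalDist_lt hd hhom h0 hint h, sub_self, abs_zero]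
    positivity
  -- For distant points the length `log(|Res|⁻¹) / d` of the interval containing all values
  -- suffices.
  · have h1 : 1 ≤ chordalDist P Q / ‖resultant d Ψ‖ := (one_le_div hρ0).2 (not_lt.1 h)
    refine le_trans ?_ (le_mul_of_one_le_right hlog h1)
    rw [Real.log_inv, neg_div, abs_le]
    constructor <;> linarith [hbd P, hbd Q]

end Ultrametric

/-! ### Independence of the lift and conclusion -/

/-- The functions of two lifts of the same map differ by a constant. -/
theorem IsLift.exists_gFun_eq_add {K : Type*} [NontriviallyNormedField K] [IsAlgClosed K]
    {N d : ℕ} (hd : 1 ≤ d) {φ : ℙ K (Fin (N + 1) → K) → ℙ K (Fin (N + 1) → K)}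
    {Φ Ψ : Fin (N + 1) → MvPolynomial (Fin (N + 1)) K} (hΦ : IsLift d φ Φ) (hΨ : IsLift d φ Ψ) :
    ∃ r : ℝ, ∀ P, gFun d Φ P = gFun d Ψ P + r := by
  obtain ⟨c, hc, h⟩ := hΦ.exists_polyMap_eq_smul hd hΨ
  refine ⟨1 / (d : ℝ) * Real.log ‖c‖, fun P => ?_⟩
  rw [gFun, gFun, h, norm_smul, Real.log_mul (norm_ne_zero_iff.2 hc)
    (norm_ne_zero_iff.2 (hΨ.ne_zero _ P.rep_nonzero))]
  ring

end NonarchGreen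

open NonarchGreen in
theorem theorem13 {K : Type*} [NontriviallyNormedField K] [IsUltrametricDist K] [CompleteSpace K]
    [IsAlgClosed K] (N d : ℕ) (hd : 2 ≤ d)
    (φ : ℙ K (Fin (N + 1) → K) → ℙ K (Fin (N + 1) → K)) (hφ : IsMorphismOfDegree d φ)
    (Φ : Fin (N + 1) → MvPolynomial (Fin (N + 1)) K) (hΦ : IsLift d φ Φ) :
    -- `g_Φ` may be computed from any lift of the point
    (∀ (x : Fin (N + 1) → K) (hx : x ≠ 0),
      gFun d Φ (Projectivization.mk K x hx) =
        1 / (d : ℝ) * Real.log ‖polyMap Φ x‖ - Real.log ‖x‖) ∧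
    -- `g_Φ` is Lipschitz continuous for the chordal metric
    (∃ L : ℝ, 0 ≤ L ∧ ∀ P Q : ℙ K (Fin (N + 1) → K),
      |gFun d Φ P - gFun d Φ Q| ≤ L * chordalDist P Q) ∧
    -- the explicit constants; `ρ` is any minimal resultant of `φ`
    (∃ ρ : K, IsMinimalResultant d φ ρ) ∧
    (∀ ρ : K, IsMinimalResultant d φ ρ → ρ ≠ 0 ∧
      (∀ P Q : ℙ K (Fin (N + 1) → K),
        |gFun d Φ P - gFun d Φ Q| ≤ Real.log (‖ρ‖⁻¹) / (d * ‖ρ‖) * chordalDist P Q) ∧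
      (∀ P Q : ℙ K (Fin (N + 1) → K), chordalDist P Q < ‖ρ‖ → gFun d Φ P = gFun d Φ Q)) ∧
    -- `g_Φ` is uniformly locally constant
    (∃ ε : ℝ, 0 < ε ∧ ∀ P Q : ℙ K (Fin (N + 1) → K),
      chordalDist P Q < ε → gFun d Φ P = gFun d Φ Q) := by
  have hd1 : 1 ≤ d := by omega
  have key : ∀ ρ : K, IsMinimalResultant d φ ρ → ρ ≠ 0 ∧ ‖ρ‖ ≤ 1 ∧
      (∀ P Q : ℙ K (Fin (N + 1) → K),
        |gFun d Φ P - gFun d Φ Q| ≤ Real.log (‖ρ‖⁻¹) / (d * ‖ρ‖) * chordalDist P Q) ∧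
      (∀ P Q : ℙ K (Fin (N + 1) → K), chordalDist P Q < ‖ρ‖ → gFun d Φ P = gFun d Φ Q) := by
    rintro _ ⟨Ψ, hΨ, rfl⟩
    obtain ⟨r, hr⟩ := hΦ.exists_gFun_eq_add hd1 hΨ.toIsLift
    have hρ := resultant_ne_zero hd1 hΨ.isHomogeneous hΨ.ne_zero
    refine ⟨hρ, ?_, fun P Q => ?_, fun P Q h => ?_⟩
    · have h1 : ‖(1 : Fin (N + 1) → K)‖ = 1 := norm_one
      exact (norm_resultant_le_norm_polyMap hd1 hΨ.isHomogeneous hΨ.integral 1 h1).trans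
        (norm_polyMap_le_one hΨ.integral h1.le)
    · rw [hr, hr, add_sub_add_right_eq_sub]
      exact abs_gFun_sub_le hd1 hΨ.isHomogeneous hΨ.ne_zero hΨ.integral hρ P Q
    · rw [hr, hr, gFun_eq_of_chordalDist_lt hd1 hΨ.isHomogeneous hΨ.ne_zero hΨ.integral h]
  obtain ⟨Ψ, hΨ⟩ := hΦ.exists_isMinimalLift
  have hmin : IsMinimalResultant d φ (resultant d Ψ) := ⟨Ψ, hΨ, rfl⟩
  obtain ⟨hρ, hρ1, hlip, hloc⟩ := key _ hmin
  refine ⟨gFun_mk hd1 hΦ.isHomogeneous hΦ.ne_zero, ⟨_, ?_, hlip⟩, ⟨_, hmin⟩,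
    fun ρ h => ⟨(key ρ h).1, (key ρ h).2.2⟩, ‖resultant d Ψ‖, norm_pos_iff.2 hρ, hloc⟩
  exact div_nonneg (Real.log_nonneg ((one_le_inv₀ (norm_pos_iff.2 hρ)).2 hρ1)) (by positivity)
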